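/- Let $K$ be a field of characteristic $p>0$, and let $$S=\frac{K[s,t,u,v,w,x,y,z]}{\big(su^2x^2+sv^2y^2+tuxvy+tw^2z^2\big)}.$$ For a Noetherian ring $R$ of characteristic $p$, an ideal $\mathfrak a=(x_1,\dots,x_n)$ of $R$ and $q=p^e$ with $e\ge 0$, put $\mathfrak a^{[q]}=(x_1^q,\dots,x_n^q)$. Let $R^\circ$ be the set of elements of $R$ that lie in no minimal prime of $R$. The tight closure of $\mathfrak a$ is the ideal $$\mathfrak a^*=\{r\in R:\text{ there exists } c\in R^\circ \text{ with } c\,r^q\in\mathfrak a^{[q]} \text{ for all sufficiently large } q=p^e\}.$$ The ring $R$ is called F-regular if $\mathfrak a^*=\mathfrak a$ for all ideals $\mathfrak a$ of $R$ and of all localizations of $R$. Theorem (Singh–Swanson). The ring $S$ is F-regular, and $$\bigcup_{q=p^e,\ e\ge 0}\operatorname{Ass} S/(x^q,y^q,z^q)\;=\;\bigcup_{q=p^e,\ e\ge 0}\operatorname{Ass} S/(x^q,y^q,z^q)^*,$$ and this set of prime ideals of $S$ is infinite. In particular, the set of associated primes of the tight closures of the Frobenius powers of an ideal need not be finite. 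-/

import Mathlib

open Filter

/-- In a ring in which the prime `p` is zero (the zero ring included), taking `p ^ e`-th powers
is additive. -/
theorem add_pow_prime_pow_of_natCast_eq_zero {p : ℕ} [hprime : Fact p.Prime] {R : Type*}
    [CommRing R] (hp : (p : R) = 0) (a b : R) (e : ℕ) :
    (a + b) ^ p ^ e = a ^ p ^ e + b ^ p ^ e := by
  rcases subsingleton_or_nontrivial R with hR | hR
  · exact Subsingleton.elim _ _
  · have : CharP R p := (CharP.charP_iff_prime_eq_zero hprime.out).2 hp
    exact add_pow_char_pow a b p e

/-- The Frobenius power `I^[q]`: the ideal generated by the `q`-th powers of the elements of `I`.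
When `q` is a power of the prime characteristic, it is generated by the `q`-th powers of any
system of generators of `I`; see `frobeniusPower_span`. -/
def frobeniusPower {R : Type*} [CommRing R] (I : Ideal R) (q : ℕ) : Ideal R :=
  Ideal.span ((fun a : R => a ^ q) '' (I : Set R))

theorem frobeniusPower_span {p : ℕ} [Fact p.Prime] {R : Type*} [CommRing R]
    (hp : (p : R) = 0) (A : Set R) (e : ℕ) :
    frobeniusPower (Ideal.span A) (p ^ e) = Ideal.span ((fun a : R => a ^ p ^ e) '' A) := by
  have hpos : p ^ e ≠ 0 := pow_ne_zero _ (Fact.out : p.Prime).ne_zero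
  apply le_antisymm
  · refine Ideal.span_le.2 ?_
    rintro _ ⟨a, ha, rfl⟩
    refine Submodule.span_induction (p := fun a _ =>
      a ^ p ^ e ∈ Ideal.span ((fun a : R => a ^ p ^ e) '' A)) ?_ ?_ ?_ ?_ ha
    · intro x hx
      exact Ideal.subset_span ⟨x, hx, rfl⟩
    · rw [zero_pow hpos]
      exact Ideal.zero_mem _
    · intro x y _ _ hx hy
      rw [add_pow_prime_pow_of_natCast_eq_zero hp]
      exact Ideal.add_mem _ hx hy
    · intro r x _ hx
      rw [smul_eq_mul, mul_pow]
      exact Ideal.mul_mem_left _ _ hx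
  · exact Ideal.span_mono (Set.image_mono Ideal.subset_span)

/-- `R°`: the set of elements of `R` that lie in no minimal prime ideal of `R`. -/
def minimalPrimesCompl (R : Type*) [CommRing R] : Set R :=
  {c | ∀ P ∈ minimalPrimes R, c ∉ P}

/-- The tight closure `I^*` of an ideal `I` of a ring `R` of prime characteristic `p`: the set of
all `a` for which there is a `c ∈ R°` with `c a^q ∈ I^[q]` for all large powers `q = p ^ e`.
The characteristic enters as `p = 0` in `R`, so that the zero ring (which may occur as a
localization) is allowed. -/
def tightClosure (p : ℕ) [Fact p.Prime] {R : Type*} [CommRing R] (hp : (p : R) = 0)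
    (I : Ideal R) : Ideal R where
  carrier := {a | ∃ c ∈ minimalPrimesCompl R,
    ∀ᶠ e : ℕ in atTop, c * a ^ p ^ e ∈ frobeniusPower I (p ^ e)}
  zero_mem' := by
    refine ⟨1, fun P hP h => hP.1.1.ne_top ((Ideal.eq_top_iff_one P).2 h), ?_⟩
    refine Eventually.of_forall fun e => ?_
    rw [zero_pow (pow_ne_zero _ (Fact.out : p.Prime).ne_zero), mul_zero]
    exact Ideal.zero_mem _
  add_mem' := by
    rintro a b ⟨c, hc, ha⟩ ⟨d, hd, hb⟩
    refine ⟨c * d, fun P hP h => (hP.1.1.mem_or_mem h).elim (hc P hP) (hd P hP), ?_⟩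
    filter_upwards [ha, hb] with e ha hb
    rw [add_pow_prime_pow_of_natCast_eq_zero hp,
      show c * d * (a ^ p ^ e + b ^ p ^ e) = d * (c * a ^ p ^ e) + c * (d * b ^ p ^ e) by ring]
    exact Ideal.add_mem _ (Ideal.mul_mem_left _ _ ha) (Ideal.mul_mem_left _ _ hb)
  smul_mem' := by
    rintro r a ⟨c, hc, ha⟩
    refine ⟨c, hc, ?_⟩
    filter_upwards [ha] with e ha
    rw [smul_eq_mul, mul_pow,
      show c * (r ^ p ^ e * a ^ p ^ e) = r ^ p ^ e * (c * a ^ p ^ e) by ring]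
    exact Ideal.mul_mem_left _ _ ha

theorem natCast_eq_zero_of_algebra {p : ℕ} {R : Type*} [CommRing R] (hp : (p : R) = 0)
    (A : Type*) [CommRing A] [Algebra R A] : (p : A) = 0 := by
  rw [← map_natCast (algebraMap R A) p, hp, map_zero]

/-- A (Noetherian) ring `R` of prime characteristic `p` is F-regular if every ideal of every
localization `W⁻¹R` of `R` is equal to its tight closure; `W = ⊥` gives the ideals of `R`. -/
def IsFRegular (p : ℕ) [Fact p.Prime] (R : Type*) [CommRing R] (hp : (p : R) = 0) : Prop :=
  ∀ (W : Submonoid R) (I : Ideal (Localization W)),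
    tightClosure p (natCast_eq_zero_of_algebra hp (Localization W)) I = I

namespace SinghSwanson

/-- The polynomial `s u² x² + s v² y² + t u x v y + t w² z²` in `K[s, t, u, v, w, x, y, z]`, where
the variables `s, t, u, v, w, x, y, z` are numbered `0, 1, 2, 3, 4, 5, 6, 7`. -/
noncomputable def poly (K : Type*) [Field K] : MvPolynomial (Fin 8) K :=
  let s := MvPolynomial.X 0
  let t := MvPolynomial.X 1
  let u := MvPolynomial.X 2
  let v := MvPolynomial.X 3
  let w := MvPolynomial.X 4
  let x := MvPolynomial.X 5
  let y := MvPolynomial.X 6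
  let z := MvPolynomial.X 7
  s * u ^ 2 * x ^ 2 + s * v ^ 2 * y ^ 2 + t * u * x * v * y + t * w ^ 2 * z ^ 2

/-- The hypersurface
`S = K[s, t, u, v, w, x, y, z] / (s u² x² + s v² y² + t u x v y + t w² z²)`. -/
abbrev S (K : Type*) [Field K] : Type _ :=
  MvPolynomial (Fin 8) K ⧸ Ideal.span {poly K}

/-- The image of `x` in `S`. -/
noncomputable def x (K : Type*) [Field K] : S K := Ideal.Quotient.mk _ (MvPolynomial.X 5)

/-- The image of `y` in `S`. -/
noncomputable def y (K : Type*) [Field K] : S K := Ideal.Quotient.mk _ (MvPolynomial.X 6)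

/-- The image of `z` in `S`. -/
noncomputable def z (K : Type*) [Field K] : S K := Ideal.Quotient.mk _ (MvPolynomial.X 7)

/-- The ideal `(x^q, y^q, z^q)` of `S`. -/
noncomputable def powIdeal (K : Type*) [Field K] (q : ℕ) : Ideal (S K) :=
  Ideal.span {x K ^ q, y K ^ q, z K ^ q}

theorem natCast_eq_zero (p : ℕ) (K : Type*) [Field K] [CharP K p] : (p : S K) = 0 :=
  natCast_eq_zero_of_algebra (CharP.cast_eq_zero K p) (S K)

end SinghSwanson

/-! Write f = sA + tB for the defining polynomial, with A = u²x² + v²y² and B = uxvy + w²z².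

F-regularity: if every nonzero c is sent to 1 by a p⁻ᵉ-linear map ψ, applying ψ to c·a^q ∈ I^[q]
gives a ∈ I, and this passes to localizations after clearing denominators. Such maps come from
Fedder's construction: a p⁻ᵉ-linear map of the polynomial ring, premultiplied by f^(q-1), descends
to S. As f is linear in s, a power of A turns c into an s-free polynomial. One map sends that
polynomial to A (`exists_splitting_eq_sCoeff`), a second sends A to 1 (`exists_splitting_eq_one`).
The two unions are then equal because tight closure does nothing.

Infinitude: modulo (x^q, y^q, z^q), multiples of f impose a three-term recurrence on the strip
monomials m_0, …, m_n, with m_0 = m_n = 0. Solving it shows that s·h_n(s,t) kills m_1, where h is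
`lucasSeq`; a linear functional shows that no power of s does. So some associated prime contains h_n
but not s. A prime avoiding s cannot contain h_l and h_m for coprime l and m, so distinct prime
indices n give distinct associated primes. -/

/-! ### F-regularity from Frobenius splittings -/

/-- Every nonzero element of `R` is sent to `1` by some `p⁻ᵉ`-linear map, for all large `e`. -/
def HasFrobeniusSplittings (p : ℕ) (R : Type*) [CommRing R] : Prop :=
  ∀ c : R, c ≠ 0 → ∃ e₀ : ℕ, ∀ e ≥ e₀, ∃ ψ : R →+ R,
    (∀ a b, ψ (a ^ p ^ e * b) = a * ψ b) ∧ ψ c = 1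

theorem apply_mem_of_mem_frobeniusPower {R : Type*} [CommRing R] {q : ℕ} (ψ : R →+ R)
    (hψ : ∀ a b, ψ (a ^ q * b) = a * ψ b) (I : Ideal R) {a : R} (ha : a ∈ frobeniusPower I q) :
    ψ a ∈ I := by
  -- `ψ` is not `R`-linear, so closure under scalars has to be built into the induction.
  suffices ∀ r, ψ (r * a) ∈ I by simpa using this 1
  refine Submodule.span_induction (p := fun a _ => ∀ r, ψ (r * a) ∈ I) ?_ ?_ ?_ ?_ ha
  · rintro _ ⟨x, hx, rfl⟩ r
    rw [mul_comm]
    simp only [hψ]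
    exact I.mul_mem_right _ hx
  · simp
  · intro x y _ _ hx hy r
    rw [mul_add, map_add]
    exact I.add_mem (hx r) (hy r)
  · intro s x _ hx r
    rw [smul_eq_mul, ← mul_assoc]
    exact hx _

theorem frobeniusPower_le_map_comap {R A : Type*} [CommRing R] [CommRing A] [Algebra R A]
    (W : Submonoid R) [IsLocalization W A] (I : Ideal A) (q : ℕ) :
    frobeniusPower I q ≤
      (frobeniusPower (I.comap (algebraMap R A)) q).map (algebraMap R A) := by
  refine Ideal.span_le.2 ?_
  rintro _ ⟨b, hb, rfl⟩
  obtain ⟨r, w, rfl⟩ := IsLocalization.exists_mk'_eq W b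
  have hr : algebraMap R A r ∈ I := by
    rw [← IsLocalization.mk'_spec A r w]
    exact I.mul_mem_right _ hb
  have h : algebraMap R A (r ^ q) ∈
      (frobeniusPower (I.comap (algebraMap R A)) q).map (algebraMap R A) :=
    Ideal.mem_map_of_mem _ (Ideal.subset_span ⟨r, hr, rfl⟩)
  show IsLocalization.mk' A r w ^ q ∈ _
  rw [← IsLocalization.mk'_pow, IsLocalization.mk'_eq_mul_mk'_one]
  exact Ideal.mul_mem_right _ _ h

theorem le_tightClosure (p : ℕ) [Fact p.Prime] {R : Type*} [CommRing R] (hp : (p : R) = 0)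
    (I : Ideal R) : I ≤ tightClosure p hp I := by
  intro a ha
  refine ⟨1, fun P hP h => hP.1.1.ne_top ((Ideal.eq_top_iff_one P).2 h), ?_⟩
  exact Eventually.of_forall fun e => Ideal.mul_mem_left _ _ (Ideal.subset_span ⟨a, ha, rfl⟩)

/-- A single large exponent suffices: after clearing denominators, `ψ` extracts the q-th root of the
membership and sends the multiplier `c` to 1. -/
theorem tightClosure_eq_self_of_hasFrobeniusSplittings (p : ℕ) [Fact p.Prime] {R A : Type*}
    [CommRing R] [IsDomain R] [CommRing A] [Algebra R A] (h : HasFrobeniusSplittings p R)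
    (W : Submonoid R) (hW : W ≤ nonZeroDivisors R) [IsLocalization W A] (hp : (p : A) = 0)
    (I : Ideal A) : tightClosure p hp I = I := by
  refine le_antisymm ?_ (le_tightClosure p hp I)
  rintro a ⟨c, hc, ha⟩
  have : IsDomain A := IsLocalization.isDomain_of_le_nonZeroDivisors A hW
  have hc0 : c ≠ 0 := fun h0 => hc ⊥ (by simp [IsDomain.minimalPrimes_eq_singleton_bot]) h0
  obtain ⟨c, w, rfl⟩ := IsLocalization.exists_mk'_eq W c
  obtain ⟨a, w', rfl⟩ := IsLocalization.exists_mk'_eq W a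
  have hc1 : c ≠ 0 := by
    rintro rfl
    exact hc0 (IsLocalization.mk'_zero w)
  obtain ⟨e₀, he₀⟩ := h c hc1
  obtain ⟨e, he, hae⟩ := ((eventually_ge_atTop e₀).and ha).exists
  obtain ⟨ψ, hψ, hψc⟩ := he₀ e he
  set q := p ^ e with hq
  have h1 := frobeniusPower_le_map_comap W I q hae
  rw [← IsLocalization.mk'_pow, ← IsLocalization.mk'_mul, IsLocalization.mk'_mem_map_algebraMap_iff]
    at h1
  obtain ⟨v, hv, h1⟩ := h1
  have hq1 : q ≠ 0 := pow_ne_zero _ (Fact.out : p.Prime).ne_zero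
  -- The denominator `v` is completed to a q-th power so that it can leave `ψ` together with `a`.
  have h2 : (v * a) ^ q * c ∈ frobeniusPower (I.comap (algebraMap R A)) q := by
    have := Ideal.mul_mem_left _ (v ^ (q - 1)) h1
    have e1 : v ^ (q - 1) * (v * (c * a ^ q)) = (v * a) ^ q * c := by
      rw [mul_pow, ← mul_assoc, pow_sub_one_mul hq1]; ring
    rwa [e1] at this
  have h3 := apply_mem_of_mem_frobeniusPower ψ hψ _ h2
  rw [hψ, hψc, mul_one] at h3
  rw [IsLocalization.mk'_mem_iff]
  have h4 : algebraMap R A v * algebraMap R A a ∈ I := by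
    rw [← map_mul]; exact h3
  exact (I.unit_mul_mem_iff_mem (IsLocalization.map_units A ⟨v, hv⟩)).1 h4

theorem isFRegular_of_hasFrobeniusSplittings (p : ℕ) [Fact p.Prime] {R : Type*} [CommRing R]
    [IsDomain R] (hp : (p : R) = 0) (h : HasFrobeniusSplittings p R) : IsFRegular p R hp := by
  intro W I
  by_cases h0 : (0 : R) ∈ W
  · have : Subsingleton (Localization W) := IsLocalization.subsingleton h0
    exact Subsingleton.elim _ _
  · exact tightClosure_eq_self_of_hasFrobeniusSplittings p h W
      (le_nonZeroDivisors_of_noZeroDivisors h0) _ I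

/-! ### p⁻ᵉ-linear maps on fields and polynomial rings -/

/-- View `K` as a vector space over itself through the e-th Frobenius; a nonzero vector takes the
value 1 under some functional. `K` need be neither perfect nor F-finite. -/
theorem Field.exists_addMonoidHom_apply_eq_one (p : ℕ) [Fact p.Prime] {K : Type*} [Field K]
    [CharP K p] (e : ℕ) {k : K} (hk : k ≠ 0) :
    ∃ l : K →+ K, (∀ a b, l (a ^ p ^ e * b) = a * l b) ∧ l k = 1 := by
  have aux : ∀ (V : Type _) [AddCommGroup V] [Module K V] (v : V), v ≠ 0 →
      ∃ l : V →+ K, (∀ (a : K) b, l (a • b) = a * l b) ∧ l v = 1 := by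
    intro V _ _ v hv
    obtain ⟨l, hl⟩ := Module.Projective.exists_dual_eq_one K hv
    exact ⟨l.toAddMonoidHom, l.map_smul, hl⟩
  exact @aux K _ (Module.compHom K (iterateFrobenius K p e)) k hk

open MvPolynomial in
-- The map keeps the monomials whose exponents are congruent to `α` mod q, takes the q-th root of
-- what remains, and applies `l` to coefficients. The bound on `α` makes it p⁻ᵉ-linear: subtracting
-- qδ from α + qγ is possible exactly when δ ≤ γ.
theorem MvPolynomial.exists_frobeniusTrace (p : ℕ) [Fact p.Prime] {σ K : Type*} [Field K]
    [CharP K p] (e : ℕ) (l : K →+ K) (hl : ∀ a b, l (a ^ p ^ e * b) = a * l b)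
    (α : σ →₀ ℕ) (hα : ∀ i, α i < p ^ e) :
    ∃ Φ : MvPolynomial σ K →+ MvPolynomial σ K,
      (∀ b γ, coeff γ (Φ b) = l (coeff (α + p ^ e • γ) b)) ∧
      ∀ a b, Φ (a ^ p ^ e * b) = a * Φ b := by
  classical
  have hq : p ^ e ≠ 0 := pow_ne_zero _ (Fact.out : p.Prime).ne_zero
  have hinj : Function.Injective fun γ : σ →₀ ℕ => α + p ^ e • γ := by
    intro γ δ h
    ext i
    have := DFunLike.congr_fun h i
    exact Nat.eq_of_mul_eq_mul_left (Nat.pos_of_ne_zero hq) (by simpa using this)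
  let F : MvPolynomial σ K → MvPolynomial σ K := fun b =>
    ∑ γ ∈ b.support.preimage _ hinj.injOn, monomial γ (l (coeff (α + p ^ e • γ) b))
  have hF : ∀ b γ, coeff γ (F b) = l (coeff (α + p ^ e • γ) b) := by
    intro b γ
    simp only [F, coeff_sum, coeff_monomial, Finset.sum_ite_eq', Finset.mem_preimage,
      mem_support_iff]
    split_ifs with h
    · rfl
    · rw [not_not.1 h, map_zero]
  let Φ : MvPolynomial σ K →+ MvPolynomial σ K :=
    { toFun := F
      map_zero' := by ext γ; simp [hF]
      map_add' := fun a b => by ext γ; simp [hF] }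
  refine ⟨Φ, hF, fun a b => ?_⟩
  induction a using MvPolynomial.induction_on' with
  | monomial δ k =>
    ext γ
    rw [monomial_pow, coeff_monomial_mul']
    show coeff γ (F _) = _
    rw [hF, coeff_monomial_mul']
    have hle : p ^ e • δ ≤ α + p ^ e • γ ↔ δ ≤ γ := by
      refine ⟨fun h i => ?_, fun h => le_add_left (nsmul_le_nsmul_right h _)⟩
      have := h i
      simp only [Finsupp.smul_apply, Finsupp.add_apply, smul_eq_mul] at this
      by_contra! hlt
      have h1 := hα i
      have : p ^ e * (γ i + 1) ≤ p ^ e * δ i := Nat.mul_le_mul_left _ hlt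
      rw [mul_add] at this
      omega
    simp only [hle]
    split_ifs with h
    · rw [hl]
      congr 1
      show _ = coeff _ (F b)
      rw [hF]
      congr 2
      obtain ⟨c, rfl⟩ := le_iff_exists_add.1 h
      rw [nsmul_add, add_tsub_cancel_left, add_left_comm, add_tsub_cancel_left]
    · exact map_zero l
  | add a a' h h' =>
    rw [add_pow_char_pow, add_mul, map_add, h, h', add_mul]

/-! ### The hypersurface is a domain; elimination of s -/

namespace SinghSwanson

open MvPolynomial

/-- The coefficient `u² x² + v² y²` of `s` in the defining polynomial. -/
noncomputable def sCoeff (K : Type*) [Field K] : MvPolynomial (Fin 8) K :=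
  X 2 ^ 2 * X 5 ^ 2 + X 3 ^ 2 * X 6 ^ 2

/-- The coefficient `u x v y + w² z²` of `t` in the defining polynomial. -/
noncomputable def tCoeff (K : Type*) [Field K] : MvPolynomial (Fin 8) K :=
  X 2 * X 5 * X 3 * X 6 + X 4 ^ 2 * X 7 ^ 2

variable (K : Type*) [Field K]

theorem poly_eq : poly K = sCoeff K * X 0 + X 1 * tCoeff K := by
  simp only [poly, sCoeff, tCoeff]
  ring

theorem X_mem_supported_of_ne_zero {i : Fin 8} (hi : i ≠ 0) :
    (X i : MvPolynomial (Fin 8) K) ∈ supported K {j : Fin 8 | j ≠ 0} :=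
  MvPolynomial.X_mem_supported.2 hi

theorem sCoeff_mem_supported : sCoeff K ∈ supported K {j : Fin 8 | j ≠ 0} := by
  have h := fun i => X_mem_supported_of_ne_zero K (i := i)
  exact add_mem (mul_mem (pow_mem (h 2 (by decide)) _) (pow_mem (h 5 (by decide)) _))
    (mul_mem (pow_mem (h 3 (by decide)) _) (pow_mem (h 6 (by decide)) _))

theorem tCoeff_mem_supported : tCoeff K ∈ supported K {j : Fin 8 | j ≠ 0} := by
  have h := fun i => X_mem_supported_of_ne_zero K (i := i)
  exact add_mem (mul_mem (mul_mem (mul_mem (h 2 (by decide)) (h 5 (by decide))) (h 3 (by decide)))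
    (h 6 (by decide))) (mul_mem (pow_mem (h 4 (by decide)) _) (pow_mem (h 7 (by decide)) _))

theorem notMem_vars_of_mem_supported {b : MvPolynomial (Fin 8) K}
    (hb : b ∈ supported K {j : Fin 8 | j ≠ 0}) : 0 ∉ b.vars :=
  fun h => mem_supported.1 hb h rfl

/-- At the point u = x = 1, all other coordinates 0, `sCoeff` equals 1. -/
theorem not_dvd_sCoeff {b : MvPolynomial (Fin 8) K}
    (hb : eval (fun i : Fin 8 => if i = 2 ∨ i = 5 then 1 else 0) b = 0) : ¬ b ∣ sCoeff K := by
  rintro ⟨c, hc⟩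
  have := congrArg (eval (fun i : Fin 8 => if i = 2 ∨ i = 5 then (1 : K) else 0)) hc
  rw [map_mul, hb] at this
  simp [sCoeff] at this

theorem sCoeff_ne_zero : sCoeff K ≠ 0 := fun h => not_dvd_sCoeff K (b := 0) (by simp) (by simp [h])

/-- It is linear in y, with coprime coefficients uxv and w²z². -/
theorem irreducible_tCoeff : Irreducible (tCoeff K) := by
  have h : tCoeff K = (X 2 * X 5 * X 3) * X 6 + X 4 ^ 2 * X 7 ^ 2 := rfl
  have hs : ∀ {i : Fin 8}, i ≠ 6 → X i ∈ supported K {j : Fin 8 | j ≠ 6} :=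
    fun hi => MvPolynomial.X_mem_supported.2 hi
  rw [h]
  refine irreducible_mul_X_add _ _ _ ?_ ?_ ?_ ?_
  · simp
  · exact fun h => mem_supported.1 (mul_mem (mul_mem (hs (i := 2) (by decide)) (hs (i := 5)
      (by decide))) (hs (i := 3) (by decide))) h rfl
  · exact fun h => mem_supported.1 (mul_mem (pow_mem (hs (i := 4) (by decide)) 2)
      (pow_mem (hs (i := 7) (by decide)) 2)) h rfl
  · have hij : ∀ i j : Fin 8, i ≠ j → IsRelPrime (X i : MvPolynomial (Fin 8) K) (X j) := by
      intro i j hij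
      rw [X_prime.irreducible.isRelPrime_iff_not_dvd, X_dvd_X]
      simpa using hij
    refine IsRelPrime.mul_left (IsRelPrime.mul_left ?_ ?_) ?_ <;>
    exact IsRelPrime.mul_right (hij _ _ (by decide)).pow_right (hij _ _ (by decide)).pow_right

theorem irreducible_poly : Irreducible (poly K) := by
  rw [poly_eq]
  refine irreducible_mul_X_add _ _ _ (sCoeff_ne_zero K)
    (notMem_vars_of_mem_supported K (sCoeff_mem_supported K))
    (notMem_vars_of_mem_supported K
      (mul_mem (X_mem_supported_of_ne_zero K (by decide)) (tCoeff_mem_supported K))) ?_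
  refine IsRelPrime.mul_right ?_ ?_
  · refine (X_prime.irreducible.isRelPrime_iff_not_dvd.2 (not_dvd_sCoeff K ?_)).symm
    simp
  · refine ((irreducible_tCoeff K).isRelPrime_iff_not_dvd.2 (not_dvd_sCoeff K ?_)).symm
    simp [tCoeff]

instance : (Ideal.span {poly K}).IsPrime :=
  (Ideal.span_singleton_prime (irreducible_poly K).ne_zero).2 (irreducible_poly K).prime

instance : IsDomain (S K) := Ideal.Quotient.isDomain _

/-- Every element becomes, after multiplication by a power of the coefficient of `s`, congruent
to a polynomial without `s`. -/
theorem exists_pow_mul_sub_mem (c : MvPolynomial (Fin 8) K) :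
    ∃ M : ℕ, ∃ c' ∈ supported K {j : Fin 8 | j ≠ 0}, sCoeff K ^ M * c - c' ∈ Ideal.span {poly K} := by
  have hA := sCoeff_mem_supported K
  induction c using MvPolynomial.induction_on with
  | C k => exact ⟨0, C k, Subalgebra.algebraMap_mem _ k, by simp⟩
  | add a b ha hb =>
    obtain ⟨M, a', ha', ha⟩ := ha
    obtain ⟨N, b', hb', hb⟩ := hb
    refine ⟨M + N, sCoeff K ^ N * a' + sCoeff K ^ M * b',
      add_mem (mul_mem (pow_mem hA _) ha') (mul_mem (pow_mem hA _) hb'), ?_⟩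
    convert Ideal.add_mem _ (Ideal.mul_mem_left _ (sCoeff K ^ N) ha)
      (Ideal.mul_mem_left _ (sCoeff K ^ M) hb) using 1
    ring
  | mul_X a i ha =>
    obtain ⟨M, a', ha', ha⟩ := ha
    by_cases hi : i = 0
    · subst hi
      -- In S, sA = -tB, so one more factor A trades s for -tB.
      refine ⟨M + 1, -(X 1 * tCoeff K) * a', mul_mem (neg_mem (mul_mem (X_mem_supported_of_ne_zero K (by decide))
        (tCoeff_mem_supported K))) ha', ?_⟩
      convert Ideal.add_mem _ (Ideal.mul_mem_left _ (sCoeff K * X 0) ha)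
        (Ideal.mul_mem_left _ a' (Ideal.mem_span_singleton_self (poly K))) using 1
      rw [poly_eq]
      ring
    · refine ⟨M, a' * X i, mul_mem ha' (X_mem_supported_of_ne_zero K hi), ?_⟩
      convert Ideal.mul_mem_left _ (X i) ha using 1
      ring

variable {K}

theorem coeff_X_zero_pow_mul_of_ne {m : ℕ} {b : MvPolynomial (Fin 8) K}
    (hb : b ∈ supported K {j : Fin 8 | j ≠ 0}) {β : Fin 8 →₀ ℕ} (hβ : β 0 ≠ m) :
    coeff β (X 0 ^ m * b) = 0 := by
  rw [X_pow_eq_monomial, coeff_monomial_mul', one_mul]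
  split_ifs with h
  · by_contra hne
    refine notMem_vars_of_mem_supported K hb ((mem_vars_iff_mem_support _).2 ⟨_, mem_support_iff.2 hne, ?_⟩)
    have := h 0
    simp only [Finsupp.single_eq_same] at this
    simp only [Finsupp.mem_support_iff, Finsupp.coe_tsub, Pi.sub_apply, Finsupp.single_eq_same]
    omega
  · rfl

theorem poly_pow_eq (n : ℕ) : poly K ^ n = ∑ k ∈ Finset.range (n + 1),
    X 0 ^ k * (sCoeff K ^ k * (X 1 * tCoeff K) ^ (n - k) * (n.choose k : MvPolynomial (Fin 8) K)) := by
  rw [poly_eq, add_pow]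
  refine Finset.sum_congr rfl fun k _ => ?_
  ring

/-! ### Frobenius splittings of the hypersurface -/

variable (p : ℕ) [Fact p.Prime] [CharP K p]

/-- The trace selects s-exponents congruent to -1 mod q. In f^(q-1)·A·c only the top term
s^(q-1)·A^(q-1)·A·c qualifies; A^q leaves as A, and the exponent `β` comes from the support of c so
that the rest maps to 1. -/
theorem exists_splitting_eq_sCoeff {c : MvPolynomial (Fin 8) K} (hc : c ≠ 0)
    (hcs : c ∈ supported K {j : Fin 8 | j ≠ 0}) (e : ℕ) (he : c.totalDegree < p ^ e) :
    ∃ Φ : MvPolynomial (Fin 8) K →+ MvPolynomial (Fin 8) K,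
      (∀ a b, Φ (a ^ p ^ e * b) = a * Φ b) ∧
      Φ (poly K ^ (p ^ e - 1) * sCoeff K * c) = sCoeff K := by
  obtain ⟨β, hβ⟩ := support_nonempty.2 hc
  obtain ⟨l, hl, hlβ⟩ := Field.exists_addMonoidHom_apply_eq_one p e (mem_support_iff.1 hβ)
  set q := p ^ e with hq
  have hβ0 : β 0 = 0 := by
    by_contra h
    exact notMem_vars_of_mem_supported K hcs
      ((mem_vars_iff_mem_support _).2 ⟨β, hβ, Finsupp.mem_support_iff.2 h⟩)
  have hβq : ∀ i, β i < q := fun i =>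
    (Finsupp.le_degree i β).trans_lt ((le_totalDegree hβ).trans_lt he)
  obtain ⟨Φ, hΦ, hlin⟩ := MvPolynomial.exists_frobeniusTrace p e l hl
    (β + Finsupp.single 0 (q - 1)) (by
      intro i
      have := hβq i
      by_cases hi : i = 0
      · subst hi; simp; omega
      · simpa [Finsupp.single_apply, Ne.symm hi] using this)
  refine ⟨Φ, hlin, ?_⟩
  have hq0 : 0 < q := (Nat.zero_le _).trans_lt he
  have key : Φ (X 0 ^ (q - 1) * c) = 1 := by
    ext γ
    rw [hΦ, X_pow_eq_monomial, add_right_comm, add_comm, coeff_monomial_mul, one_mul]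
    by_cases hγ : γ = 0
    · simp [hγ, hlβ]
    -- For γ ≠ 0 the exponent β + qγ has degree at least q, above the degree of c.
    · rw [coeff_one, if_neg (Ne.symm hγ), coeff_eq_zero_of_totalDegree_lt, map_zero]
      refine he.trans_le ?_
      obtain ⟨i, hi⟩ := Finsupp.ne_iff.1 hγ
      have h1 := Finsupp.le_degree i (β + q • γ)
      have h2 : q * 1 ≤ q * γ i := Nat.mul_le_mul_left _ (Nat.one_le_iff_ne_zero.2 hi)
      simp only [Finsupp.add_apply, Finsupp.smul_apply, smul_eq_mul] at h1
      change _ ≤ (β + q • γ).degree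
      omega
  have hA := sCoeff_mem_supported K
  rw [mul_assoc, poly_pow_eq, Finset.sum_mul, map_sum, Finset.sum_range_succ, Finset.sum_eq_zero]
  · have e1 : X 0 ^ (q - 1) * (sCoeff K ^ (q - 1) * (X 1 * tCoeff K) ^ (q - 1 - (q - 1)) *
        ((q - 1).choose (q - 1) : MvPolynomial (Fin 8) K)) * (sCoeff K * c) =
        sCoeff K ^ q * (X 0 ^ (q - 1) * c) := by
      rw [← pow_sub_one_mul hq0.ne' (sCoeff K)]
      simp
      ring
    rw [e1, hlin, key, zero_add, mul_one]
  · intro k hk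
    have hk := Finset.mem_range.1 hk
    ext γ
    rw [hΦ, mul_assoc, coeff_X_zero_pow_mul_of_ne, map_zero, coeff_zero]
    · exact mul_mem (mul_mem (mul_mem (pow_mem hA _) (pow_mem (mul_mem (X_mem_supported_of_ne_zero K (by decide))
        (tCoeff_mem_supported K)) _)) (natCast_mem _ _)) (mul_mem hA hcs)
    · simp only [Finsupp.add_apply, Finsupp.smul_apply, Finsupp.single_eq_same, hβ0]
      omega

variable (K) in
-- Pascal's rule, with C(q,1) and C(q,2) zero in K, forces C(q-1,k) = (-1)^k for k ≤ 2.
theorem natCast_choose_two_eq_one (e : ℕ) (he : 3 ≤ p ^ e) :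
    (((p ^ e - 1).choose 2 : ℕ) : K) = 1 := by
  obtain ⟨n, hn⟩ : ∃ n, p ^ e = n + 1 := ⟨p ^ e - 1, by omega⟩
  have h : ∀ k, k ≠ 0 → k ≠ p ^ e → (((p ^ e).choose k : ℕ) : K) = 0 := fun k h0 h1 =>
    (CharP.cast_eq_zero_iff K p _).2 ((Fact.out : p.Prime).dvd_choose_pow h0 h1)
  have h1 := h 1 one_ne_zero (by omega)
  have h2 := h 2 two_ne_zero (by omega)
  rw [hn, Nat.choose_succ_succ', Nat.cast_add] at h1 h2
  simp only [Nat.choose_zero_right, zero_add, Nat.cast_one, Nat.reduceAdd] at h1 h2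
  rw [hn, Nat.add_sub_cancel]
  linear_combination h2 - h1

theorem X_pow_prod_eq_monomial (v : Fin 8 → ℕ) :
    X 0 ^ v 0 * X 1 ^ v 1 * X 2 ^ v 2 * X 3 ^ v 3 * X 4 ^ v 4 * X 5 ^ v 5 * X 6 ^ v 6 * X 7 ^ v 7 =
      monomial (Finsupp.equivFunOnFinite.symm v) (1 : K) := by
  rw [monomial_eq, Finsupp.prod_fintype _ _ (by simp), Fin.prod_univ_eight]
  simp

theorem exists_splitting_eq_one (e : ℕ) (he : 5 ≤ p ^ e) :
    ∃ Φ : MvPolynomial (Fin 8) K →+ MvPolynomial (Fin 8) K, ∃ g : MvPolynomial (Fin 8) K,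
      (∀ a b, Φ (a ^ p ^ e * b) = a * Φ b) ∧
      Φ (poly K ^ (p ^ e - 1) * g * sCoeff K) = 1 := by
  obtain ⟨l, hl, hl1⟩ := Field.exists_addMonoidHom_apply_eq_one p e (one_ne_zero (α := K))
  have hchoose := natCast_choose_two_eq_one K p e (by omega)
  set q := p ^ e with hq
  obtain ⟨Φ, hΦ, hlin⟩ := MvPolynomial.exists_frobeniusTrace p e l hl
    (Finsupp.equivFunOnFinite.symm fun _ : Fin 8 => q - 1) (by intro i; simp; omega)
  have hzero : ∀ (v : Fin 8 → ℕ) (i : Fin 8) (k : K), (∀ m, v i ≠ q - 1 + q * m) →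
      Φ (monomial (Finsupp.equivFunOnFinite.symm v) k) = 0 := by
    intro v i k hv
    ext γ
    rw [hΦ, coeff_monomial, if_neg, map_zero, coeff_zero]
    intro h
    exact hv (γ i) (by simpa using DFunLike.congr_fun h i)
  have hone : Φ (monomial (Finsupp.equivFunOnFinite.symm fun _ : Fin 8 => q - 1) 1) = 1 := by
    ext γ
    rw [hΦ, coeff_monomial, coeff_one]
    by_cases h : γ = 0
    · simp [h, hl1]
    · rw [if_neg, if_neg (Ne.symm h), map_zero]
      intro h'
      obtain ⟨i, hi⟩ := Finsupp.ne_iff.1 h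
      have h2 : q - 1 = q - 1 + q * γ i := DFunLike.congr_fun h' i
      exact hi ((Nat.mul_eq_zero.1 (show q * γ i = 0 by omega)).resolve_left (by omega))
  have hnat : ∀ (n : ℕ) b, Φ (b * (n : MvPolynomial (Fin 8) K)) = Φ b * n := by
    intro n b
    rw [mul_comm, ← nsmul_eq_mul, map_nsmul, nsmul_eq_mul, mul_comm]
  have hA := sCoeff_mem_supported K
  have hX := fun i => X_mem_supported_of_ne_zero K (i := i)
  set h : MvPolynomial (Fin 8) K := (X 3 * X 6) ^ 2 * (X 4 * X 7) ^ (q - 5) with hh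
  have hhs : h ∈ supported K {j : Fin 8 | j ≠ 0} :=
    mul_mem (pow_mem (mul_mem (hX 3 (by decide)) (hX 6 (by decide))) _)
      (pow_mem (mul_mem (hX 4 (by decide)) (hX 7 (by decide))) _)
  -- The factor s^(q-1) removes every term of f^(q-1) of positive s-degree, leaving (tB)^(q-1). The
  -- factor (vy)²(wz)^(q-5) is chosen so that, with the u²x² of A, only (uxvy)^(q-3)(w²z²)² reaches
  -- exponent q-1 everywhere; its coefficient is C(q-1,2) = 1.
  refine ⟨Φ, X 0 ^ (q - 1) * h, hlin, ?_⟩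
  rw [mul_assoc, poly_pow_eq, Finset.sum_mul, map_sum, Finset.sum_eq_single 0]
  rotate_left
  · intro k hk hk0
    have hk := Finset.mem_range.1 hk
    rw [show ∀ a b : MvPolynomial (Fin 8) K, X 0 ^ k * a * (X 0 ^ (q - 1) * h * b) =
      X 0 ^ (k + (q - 1)) * (a * (h * b)) by intros; ring]
    ext γ
    rw [hΦ, coeff_X_zero_pow_mul_of_ne, map_zero, coeff_zero]
    · exact mul_mem (mul_mem (mul_mem (pow_mem hA _) (pow_mem (mul_mem (hX 1 (by decide))
        (tCoeff_mem_supported K)) _)) (natCast_mem _ _)) (mul_mem hhs hA)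
    · show q - 1 + q * γ 0 ≠ _
      rcases Nat.eq_zero_or_pos (γ 0) with h0 | h0
      · rw [h0]; omega
      · have := Nat.mul_le_mul_left q h0
        omega
  · simp
  rw [pow_zero, pow_zero, one_mul, one_mul, Nat.choose_zero_right, Nat.cast_one, mul_one, mul_pow,
    tCoeff, add_pow, Finset.mul_sum, Finset.sum_mul, map_sum, Nat.sub_zero]
  have hterm : ∀ j ∈ Finset.range (q - 1 + 1),
      Φ (X 1 ^ (q - 1) * ((X 2 * X 5 * X 3 * X 6) ^ j * (X 4 ^ 2 * X 7 ^ 2) ^ (q - 1 - j) *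
        ((q - 1).choose j : MvPolynomial (Fin 8) K)) * (X 0 ^ (q - 1) * h * sCoeff K)) =
      if j = q - 3 then 1 else 0 := by
    intro j hj
    have hj := Finset.mem_range.1 hj
    have e1 := X_pow_prod_eq_monomial (K := K) ![q - 1, q - 1, j + 2, j + 2,
      2 * (q - 1 - j) + (q - 5), j + 2, j + 2, 2 * (q - 1 - j) + (q - 5)]
    have e2 := X_pow_prod_eq_monomial (K := K) ![q - 1, q - 1, j, j + 4,
      2 * (q - 1 - j) + (q - 5), j, j + 4, 2 * (q - 1 - j) + (q - 5)]
    simp only [Matrix.cons_val] at e1 e2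
    rw [show X 1 ^ (q - 1) * ((X 2 * X 5 * X 3 * X 6) ^ j * (X 4 ^ 2 * X 7 ^ 2) ^ (q - 1 - j) *
        ((q - 1).choose j : MvPolynomial (Fin 8) K)) * (X 0 ^ (q - 1) * h * sCoeff K) =
        (X 0 ^ (q - 1) * X 1 ^ (q - 1) * X 2 ^ (j + 2) * X 3 ^ (j + 2) *
          X 4 ^ (2 * (q - 1 - j) + (q - 5)) * X 5 ^ (j + 2) * X 6 ^ (j + 2) *
          X 7 ^ (2 * (q - 1 - j) + (q - 5)) +
        X 0 ^ (q - 1) * X 1 ^ (q - 1) * X 2 ^ j * X 3 ^ (j + 4) *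
          X 4 ^ (2 * (q - 1 - j) + (q - 5)) * X 5 ^ j * X 6 ^ (j + 4) *
          X 7 ^ (2 * (q - 1 - j) + (q - 5))) * ((q - 1).choose j : MvPolynomial (Fin 8) K) by
        rw [hh, sCoeff]; ring, e1, e2, hnat, map_add]
    have h2 : Φ (monomial (Finsupp.equivFunOnFinite.symm ![q - 1, q - 1, j, j + 4,
        2 * (q - 1 - j) + (q - 5), j, j + 4, 2 * (q - 1 - j) + (q - 5)]) (1 : K)) = 0 := by
      -- These are the terms from v²y² in A. If j = q-1 the v-exponent is q+3, not -1 mod q since q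
      -- ≥ 5; otherwise the u-exponent is below q-1.
      by_cases hjq : j = q - 1
      · refine hzero _ 3 _ fun m hm => ?_
        simp only [Matrix.cons_val] at hm
        rcases Nat.eq_zero_or_pos m with rfl | h0
        · omega
        · have := Nat.mul_le_mul_left q h0
          omega
      · refine hzero _ 2 _ fun m hm => ?_
        simp only [Matrix.cons_val] at hm
        omega
    rw [h2, add_zero]
    split_ifs with hjq
    · have : ![q - 1, q - 1, j + 2, j + 2, 2 * (q - 1 - j) + (q - 5), j + 2, j + 2,
          2 * (q - 1 - j) + (q - 5)] = fun _ => q - 1 := by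
        ext i
        fin_cases i <;> simp <;> omega
      rw [this, hone, one_mul, hjq, ← Nat.choose_symm_of_eq_add (show q - 1 = 2 + (q - 3) by omega),
        ← map_natCast C, hchoose, map_one]
    · rw [hzero _ 2, zero_mul]
      intro m hm
      simp only [Matrix.cons_val] at hm
      rcases Nat.eq_zero_or_pos m with rfl | h0
      · omega
      · have := Nat.mul_le_mul_left q h0
        omega
  rw [Finset.sum_congr rfl hterm, Finset.sum_ite_eq', if_pos (Finset.mem_range.2 (by omega))]

/-- Fedder's construction of `p⁻ᵉ`-linear maps on a hypersurface. -/
theorem exists_descend (q : ℕ) (hq : q ≠ 0) (Φ : MvPolynomial (Fin 8) K →+ MvPolynomial (Fin 8) K)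
    (hΦ : ∀ a b, Φ (a ^ q * b) = a * Φ b) (g : MvPolynomial (Fin 8) K) :
    ∃ ψ : S K →+ S K, (∀ a b, ψ (a ^ q * b) = a * ψ b) ∧
      ∀ b, ψ (Ideal.Quotient.mk _ b) = Ideal.Quotient.mk _ (Φ (poly K ^ (q - 1) * g * b)) := by
  let π : MvPolynomial (Fin 8) K →+* S K := Ideal.Quotient.mk _
  have hπ : Function.Surjective π := Ideal.Quotient.mk_surjective
  let Ψ : MvPolynomial (Fin 8) K →+ S K :=
    (π.toAddMonoidHom.comp Φ).comp (AddMonoidHom.mulLeft (poly K ^ (q - 1) * g))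
  -- On a multiple of f the factor f^(q-1) becomes f^q, which leaves `Φ` as f.
  have hker : π.toAddMonoidHom.ker ≤ Ψ.ker := by
    intro b hb
    obtain ⟨c, rfl⟩ := Ideal.mem_span_singleton'.1 (Ideal.Quotient.eq_zero_iff_mem.1 hb)
    show π (Φ (poly K ^ (q - 1) * g * (c * poly K))) = 0
    rw [show poly K ^ (q - 1) * g * (c * poly K) = poly K ^ q * (g * c) by
      rw [← pow_sub_one_mul hq]; ring, hΦ]
    exact Ideal.Quotient.eq_zero_iff_mem.2
      (Ideal.mul_mem_right _ _ (Ideal.mem_span_singleton_self _))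
  let ψ := π.toAddMonoidHom.liftOfSurjective hπ ⟨Ψ, hker⟩
  have hψ : ∀ b, ψ (π b) = π (Φ (poly K ^ (q - 1) * g * b)) := fun b =>
    π.toAddMonoidHom.liftOfRightInverse_comp_apply _ _ ⟨Ψ, hker⟩ b
  refine ⟨ψ, fun a b => ?_, hψ⟩
  obtain ⟨a, rfl⟩ := hπ a
  obtain ⟨b, rfl⟩ := hπ b
  rw [← map_pow, ← map_mul, hψ, hψ, mul_left_comm, hΦ, map_mul]

theorem hasFrobeniusSplittings : HasFrobeniusSplittings p (S K) := by
  intro c hc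
  obtain ⟨c, rfl⟩ := Ideal.Quotient.mk_surjective c
  obtain ⟨M, c', hcs, hcc⟩ := exists_pow_mul_sub_mem K c
  have hcc' := Ideal.Quotient.eq.2 hcc
  have hA : Ideal.Quotient.mk (Ideal.span {poly K}) (sCoeff K) ≠ 0 := by
    rw [Ne, Ideal.Quotient.eq_zero_iff_mem, Ideal.mem_span_singleton]
    exact not_dvd_sCoeff K (by simp [poly])
  have hc0 : c' ≠ 0 := by
    rintro rfl
    rw [map_mul, map_pow, map_zero] at hcc'
    exact mul_ne_zero (pow_ne_zero _ hA) hc hcc'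
  have hp2 := (Fact.out : p.Prime).two_le
  refine ⟨c'.totalDegree + 3, fun e he => ?_⟩
  obtain ⟨e, rfl⟩ : ∃ n, e = n + 3 := ⟨e - 3, by omega⟩
  obtain ⟨Φ₁, hΦ₁, h₁⟩ := exists_splitting_eq_sCoeff p hc0 hcs e
    ((Nat.lt_pow_self hp2).trans_le (Nat.pow_le_pow_right (by omega) (by omega)))
  -- The exponent 3 is enough for every p, as p³ ≥ 8 ≥ 5.
  obtain ⟨Φ₂, g, hΦ₂, h₂⟩ := exists_splitting_eq_one (K := K) p 3
    (le_trans (by norm_num) (Nat.pow_le_pow_left hp2 3))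
  obtain ⟨ψ₁, hψ₁, h₁'⟩ := exists_descend _ (by positivity) Φ₁ hΦ₁ (sCoeff K)
  obtain ⟨ψ₂, hψ₂, h₂'⟩ := exists_descend _ (by positivity) Φ₂ hΦ₂ g
  refine ⟨(ψ₂.comp ψ₁).comp (AddMonoidHom.mulLeft (Ideal.Quotient.mk _ (sCoeff K ^ M))),
    fun a b => ?_, ?_⟩
  · simp only [AddMonoidHom.comp_apply, AddMonoidHom.coe_mulLeft]
    rw [mul_left_comm, pow_add, mul_comm (p ^ e), pow_mul, hψ₁, hψ₂]
  · simp only [AddMonoidHom.comp_apply, AddMonoidHom.coe_mulLeft]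
    rw [← map_mul, hcc', h₁', h₁, h₂', h₂, map_one]

end SinghSwanson

/-! ### Associated primes avoiding s, and divisibility of the Lucas sequence -/

/-- If `g` kills `m` and no power of `s` does, then `g` lies in an associated prime not
containing `s`. -/
theorem exists_isAssociatedPrime_notMem {R M : Type*} [CommRing R] [IsNoetherianRing R]
    [AddCommGroup M] [Module R M] (m : M) (s g : R) (hs : ∀ N : ℕ, s ^ N • m ≠ 0)
    (hg : g • m = 0) : ∃ P ∈ associatedPrimes R M, s ∉ P ∧ g ∈ P := by
  let f : ℕ →o Ideal R :=
    { toFun := fun N => (⊥ : Submodule R M).colon {s ^ N • m}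
      monotone' := monotone_nat_of_le_succ fun N r hr => by
        rw [Submodule.mem_colon_singleton, Submodule.mem_bot] at hr ⊢
        rw [pow_succ', mul_smul, smul_comm, hr, smul_zero] }
  obtain ⟨N, hN⟩ := monotone_stabilizes_iff_noetherian.2 ‹IsNoetherianRing R› f
  -- Once the annihilators stabilize, s is a nonzerodivisor on the submodule generated by s^N m,
  -- hence lies in none of its associated primes.
  have hN1 : ∀ r : R, (r * s) • (s ^ N • m) = 0 → r • (s ^ N • m) = 0 := by
    intro r hr
    have h : r ∈ f (N + 1) := by
      show r ∈ (⊥ : Submodule R M).colon {s ^ (N + 1) • m}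
      rw [Submodule.mem_colon_singleton, Submodule.mem_bot, pow_succ', mul_smul, ← mul_smul]
      exact hr
    rw [← hN (N + 1) (Nat.le_succ N)] at h
    exact Submodule.mem_colon_singleton.1 h
  let y : Submodule.span R {s ^ N • m} := ⟨_, Submodule.mem_span_singleton_self _⟩
  obtain ⟨P, hP, hle⟩ := exists_le_isAssociatedPrime_of_isNoetherianRing R y
    (fun h => hs N (congrArg Subtype.val h))
  refine ⟨P, hP.map_of_injective (Submodule.subtype _) Subtype.val_injective, fun hsP => ?_,
    hle ?_⟩
  · obtain ⟨hprime, ⟨z, hz⟩, rfl⟩ := isAssociatedPrime_iff.1 hP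
    obtain ⟨r, rfl⟩ := Submodule.mem_span_singleton.1 hz
    rw [Submodule.mem_colon_singleton, Submodule.mem_bot] at hsP
    have h1 : (r * s) • (s ^ N • m) = 0 := by
      rw [mul_comm, mul_smul]
      exact congrArg Subtype.val hsP
    refine hprime.ne_top ((Ideal.eq_top_iff_one _).2 ?_)
    rw [Submodule.mem_colon_singleton, Submodule.mem_bot, one_smul]
    exact Subtype.ext (hN1 r h1)
  · rw [Submodule.mem_colon_singleton, Submodule.mem_bot]
    refine Subtype.ext ?_
    show g • (s ^ N • m) = 0
    rw [smul_comm, hg, smul_zero]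

/-- The sequence `0, 1, -t, t² - s², …` with `h (n + 2) = - t h (n + 1) - s² h n`. -/
def lucasSeq {R : Type*} [CommRing R] (s t : R) : ℕ → R
  | 0 => 0
  | 1 => 1
  | n + 2 => -t * lucasSeq s t (n + 1) - s ^ 2 * lucasSeq s t n

theorem lucasSeq_add {R : Type*} [CommRing R] (s t : R) (m n : ℕ) :
    lucasSeq s t (m + n + 1) = lucasSeq s t (m + 1) * lucasSeq s t (n + 1) -
      s ^ 2 * lucasSeq s t m * lucasSeq s t n := by
  induction n using Nat.strong_induction_on with
  | _ n ih =>
    match n with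
    | 0 => simp [lucasSeq]
    | 1 => simp only [lucasSeq]; ring
    | n + 2 =>
      have h0 := ih n (by omega)
      have h1 := ih (n + 1) (by omega)
      rw [← add_assoc] at h1
      rw [show m + (n + 2) + 1 = (m + n + 1) + 2 by ring, lucasSeq, h0, h1]
      simp only [lucasSeq]
      ring

/-- Two consecutive terms in P would, since s² ∉ P, push the recurrence down to h_1 = 1 ∈ P. -/
theorem lucasSeq_succ_notMem {R : Type*} [CommRing R] {s t : R} {P : Ideal R} [P.IsPrime]
    (hs : s ∉ P) {n : ℕ} (hn : lucasSeq s t n ∈ P) : lucasSeq s t (n + 1) ∉ P := by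
  induction n with
  | zero => exact fun h => Ideal.IsPrime.ne_top' ((Ideal.eq_top_iff_one P).2 h)
  | succ n ih =>
    intro h
    refine ih ?_ hn
    rw [lucasSeq, P.sub_mem_iff_right (P.mul_mem_left _ hn)] at h
    exact (Ideal.IsPrime.mem_or_mem ‹_› h).resolve_left
      fun h => hs (Ideal.IsPrime.mem_of_pow_mem ‹_› _ h)

/-- Modulo P, if h_n vanishes then h_(k+n) = h_k h_(n+1) with h_(n+1) nonzero. Hence Euclid's
algorithm runs on the indices and puts h_gcd in P, while h_1 = 1. -/
theorem not_coprime_of_lucasSeq_mem {R : Type*} [CommRing R] {s t : R} {P : Ideal R} [P.IsPrime]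
    (hs : s ∉ P) {m n : ℕ} (hm : lucasSeq s t m ∈ P) (hn : lucasSeq s t n ∈ P) :
    ¬ m.Coprime n := by
  have hsub : ∀ k n, lucasSeq s t (k + n) ∈ P → lucasSeq s t n ∈ P → lucasSeq s t k ∈ P := by
    intro k n hkn hn
    cases k with
    | zero => exact P.zero_mem
    | succ k =>
      rw [show k + 1 + n = k + n + 1 by ring, lucasSeq_add,
        P.sub_mem_iff_left (P.mul_mem_left _ hn)] at hkn
      exact (Ideal.IsPrime.mem_or_mem ‹_› hkn).resolve_right (lucasSeq_succ_notMem hs hn)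
  have hgcd : lucasSeq s t (m.gcd n) ∈ P := by
    induction m, n using Nat.gcd.induction with
    | H0 n => simpa using hn
    | H1 m n hpos ih =>
      rw [Nat.gcd_rec]
      refine ih ?_ hm
      have : ∀ k r, lucasSeq s t (r + m * k) ∈ P → lucasSeq s t r ∈ P := by
        intro k
        induction k with
        | zero => exact fun r h => by simpa using h
        | succ k ih =>
          intro r h
          rw [mul_add, mul_one, ← add_assoc] at h
          exact ih r (hsub _ _ h hm)
      exact this (n / m) _ (by rwa [Nat.mod_add_div])
  intro h
  rw [h] at hgcd
  exact Ideal.IsPrime.ne_top' ((Ideal.eq_top_iff_one P).2 hgcd)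

theorem map_lucasSeq {R R' : Type*} [CommRing R] [CommRing R'] (f : R →+* R') (s t : R) (n : ℕ) :
    f (lucasSeq s t n) = lucasSeq (f s) (f t) n := by
  induction n using Nat.strong_induction_on with
  | _ n ih =>
    match n with
    | 0 => simp [lucasSeq]
    | 1 => simp [lucasSeq]
    | n + 2 => simp [lucasSeq, ih (n + 1) (by omega), ih n (by omega)]

/-- At s = 1, t = -X the recurrence is h_(n+2) = X h_(n+1) - h_n; the sign makes the terms monic.
The positive degree makes adjoining a root give a nonzero ring. -/
theorem monic_and_natDegree_lucasSeq_one_neg_X {K : Type*} [Field K] (n : ℕ) :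
    (lucasSeq (1 : Polynomial K) (-Polynomial.X) (n + 1)).Monic ∧
      (lucasSeq (1 : Polynomial K) (-Polynomial.X) (n + 1)).natDegree = n := by
  induction n using Nat.strong_induction_on with
  | _ n ih =>
    match n with
    | 0 => simp [lucasSeq]
    | 1 => simp [lucasSeq]
    | n + 2 =>
      obtain ⟨hm, hd⟩ := ih (n + 1) (by omega)
      have hd0 := (ih n (by omega)).2
      have hm0 := (ih n (by omega)).1
      have e : lucasSeq (1 : Polynomial K) (-Polynomial.X) (n + 2 + 1) =
          Polynomial.X * lucasSeq (1 : Polynomial K) (-Polynomial.X) (n + 1 + 1) -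
          lucasSeq (1 : Polynomial K) (-Polynomial.X) (n + 1) := by
        conv_lhs => rw [lucasSeq]
        ring
      have hmX := Polynomial.monic_X.mul hm
      have hdX : (Polynomial.X * lucasSeq (1 : Polynomial K) (-Polynomial.X) (n + 1 + 1)).natDegree
          = n + 2 := by
        rw [Polynomial.natDegree_X_mul hm.ne_zero, hd]
      have hlt : (lucasSeq (1 : Polynomial K) (-Polynomial.X) (n + 1)).degree <
          (Polynomial.X * lucasSeq (1 : Polynomial K) (-Polynomial.X) (n + 1 + 1)).degree := by
        refine Polynomial.degree_lt_degree ?_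
        omega
      rw [e]
      refine ⟨hmX.sub_of_left hlt, ?_⟩
      rw [Polynomial.natDegree_sub_eq_left_of_natDegree_lt (by omega), hdX]

/-- Over any field there is a nontrivial algebra in which `lucasSeq 1 τ` vanishes at a given
index `n ≥ 2`. -/
theorem exists_lucasSeq_eq_zero.{u} (K : Type u) [Field K] {n : ℕ} (hn : 2 ≤ n) :
    ∃ (B : Type u) (_ : CommRing B) (_ : Algebra K B) (_ : Nontrivial B) (τ : B),
      lucasSeq 1 τ n = 0 := by
  obtain ⟨n, rfl⟩ : ∃ k, n = k + 1 := ⟨n - 1, by omega⟩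
  have hd := (monic_and_natDegree_lucasSeq_one_neg_X (K := K) n).2
  set f := lucasSeq (1 : Polynomial K) (-Polynomial.X) (n + 1) with hf
  refine ⟨AdjoinRoot f, inferInstance, inferInstance, AdjoinRoot.nontrivial f ?_,
    AdjoinRoot.mk f (-Polynomial.X), ?_⟩
  · intro h
    have := Polynomial.natDegree_eq_zero_iff_degree_le_zero.2 h.le
    omega
  · rw [← map_one (AdjoinRoot.mk f), ← map_lucasSeq, ← hf, AdjoinRoot.mk_self]

/-! ### Associated primes of the Frobenius powers -/

namespace SinghSwanson

open MvPolynomial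

variable (K : Type*) [Field K]

/-- The preimage of `powIdeal K q` in the polynomial ring. -/
noncomputable def polyPowIdeal (q : ℕ) : Ideal (MvPolynomial (Fin 8) K) :=
  Ideal.span {X 5 ^ q, X 6 ^ q, X 7 ^ q, poly K}

theorem mk_mem_powIdeal_iff (q : ℕ) (b : MvPolynomial (Fin 8) K) :
    Ideal.Quotient.mk (Ideal.span {poly K}) b ∈ powIdeal K q ↔ b ∈ polyPowIdeal K q := by
  have h1 : powIdeal K q = (Ideal.span {X 5 ^ q, X 6 ^ q, X 7 ^ q}).map
      (Ideal.Quotient.mk (Ideal.span {poly K})) := by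
    rw [Ideal.map_span, Set.image_insert_eq, Set.image_pair]
    rfl
  have h2 : polyPowIdeal K q = Ideal.span {X 5 ^ q, X 6 ^ q, X 7 ^ q} ⊔ Ideal.span {poly K} := by
    rw [← Ideal.span_union, polyPowIdeal]
    congr 1
    ext
    simp only [Set.mem_insert_iff, Set.mem_singleton_iff, Set.mem_union]
    tauto
  rw [h1, h2, Ideal.mem_quotient_iff_mem_sup]

/-- The monomials `x^(q-n) y^(q-n) z^(q-2) (ux)^k (vy)^(n-k)`. -/
noncomputable def stripMonomial (q n k : ℕ) : MvPolynomial (Fin 8) K :=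
  X 5 ^ (q - n + k) * X 2 ^ k * X 6 ^ (q - k) * X 3 ^ (n - k) * X 7 ^ (q - 2)

/-- A monomial multiple of f gives s·m_(k+2) + t·m_(k+1) + s·m_k ≡ 0, its w²z² term falling into
(z^q). Starting from m_0 ≡ 0, a multiple of y^q, the recurrence is solved by s^k m_k ≡ s·h_k·m_1. -/
theorem X_pow_mul_stripMonomial_sub_mem {q n : ℕ} (hn : 2 ≤ n) (hq : n ≤ q) (k : ℕ) (hk : k ≤ n) :
    X 0 ^ k * stripMonomial K q n k -
      X 0 * lucasSeq (X 0) (X 1) k * stripMonomial K q n 1 ∈ polyPowIdeal K q := by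
  have hy : X 6 ^ q ∈ polyPowIdeal K q := Ideal.subset_span (by simp)
  have hz : X 7 ^ q ∈ polyPowIdeal K q := Ideal.subset_span (by simp)
  have hf : poly K ∈ polyPowIdeal K q := Ideal.subset_span (by simp)
  induction k using Nat.strong_induction_on with
  | _ k ih =>
    match k with
    | 0 =>
      have h : (X 0 ^ 0 * stripMonomial K q n 0 -
          X 0 * lucasSeq (X 0) (X 1) 0 * stripMonomial K q n 1 : MvPolynomial (Fin 8) K) =
          X 5 ^ (q - n) * X 3 ^ n * X 7 ^ (q - 2) * X 6 ^ q := by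
        simp only [stripMonomial, lucasSeq, Nat.sub_zero, add_zero]
        ring
      rw [h]
      exact Ideal.mul_mem_left _ _ hy
    | 1 =>
      simp [lucasSeq]
    | k + 2 =>
      have hstep : X 0 * stripMonomial K q n (k + 2) + X 1 * stripMonomial K q n (k + 1) +
          X 0 * stripMonomial K q n k ∈ polyPowIdeal K q := by
        obtain ⟨a, ha⟩ : ∃ a, q = a + (k + 2) := ⟨q - (k + 2), by omega⟩
        obtain ⟨b, hb⟩ : ∃ b, n = b + (k + 2) := ⟨n - (k + 2), by omega⟩
        have h : X 0 * stripMonomial K q n (k + 2) + X 1 * stripMonomial K q n (k + 1) +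
            X 0 * stripMonomial K q n k =
            X 5 ^ (q - n + k) * X 2 ^ k * X 6 ^ a * X 3 ^ b * X 7 ^ (q - 2) * poly K -
            X 5 ^ (q - n + k) * X 2 ^ k * X 6 ^ a * X 3 ^ b * X 1 * X 4 ^ 2 * X 7 ^ q := by
          simp only [stripMonomial, poly]
          rw [show q - (k + 2) = a by omega, show q - (k + 1) = a + 1 by omega,
            show q - k = a + 2 by omega, show n - (k + 2) = b by omega,
            show n - (k + 1) = b + 1 by omega, show n - k = b + 2 by omega,
            ← pow_sub_mul_pow (X 7 : MvPolynomial (Fin 8) K) (show 2 ≤ q by omega)]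
          ring
        rw [h]
        exact Ideal.sub_mem _ (Ideal.mul_mem_left _ _ hf) (Ideal.mul_mem_left _ _ hz)
      have h0 := ih k (by omega) (by omega)
      have h1 := ih (k + 1) (by omega) (by omega)
      convert Ideal.sub_mem _ (Ideal.sub_mem _ (Ideal.mul_mem_left _ (X 0 ^ (k + 1)) hstep)
        (Ideal.mul_mem_left _ (X 1) h1)) (Ideal.mul_mem_left _ (X 0 ^ 2) h0) using 1
      simp only [lucasSeq]
      ring

theorem lucasSeq_mul_stripMonomial_mem {q n : ℕ} (hn : 2 ≤ n) (hq : n ≤ q) :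
    X 0 * lucasSeq (X 0) (X 1) n * stripMonomial K q n 1 ∈ polyPowIdeal K q := by
  have h := X_pow_mul_stripMonomial_sub_mem K hn hq n le_rfl
  refine (Submodule.sub_mem_iff_right _ (Ideal.mul_mem_left _ _ ?_)).1 h
  have hx : X 5 ^ q ∈ polyPowIdeal K q := Ideal.subset_span (by simp)
  rw [stripMonomial, Nat.sub_add_cancel hq]
  simp only [mul_assoc]
  exact Ideal.mul_mem_right _ _ hx

/-- A linear functional that vanishes on `polyPowIdeal K q` and detects the strip monomials. -/
theorem exists_linearMap_polyPowIdeal {q n : ℕ} (hn : 2 ≤ n) (hq : n ≤ q) {B : Type*} [CommRing B]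
    [Algebra K B] (τ : B) (hτ : lucasSeq 1 τ n = 0) :
    ∃ L : MvPolynomial (Fin 8) K →ₗ[K] B, (∀ b ∈ polyPowIdeal K q, L b = 0) ∧
      ∀ N, L (X 0 ^ N * stripMonomial K q n 1) = 1 := by
  classical
  -- Put s = 1, t = τ, send m_k to h_k(1,τ), and every monomial off the strip to 0. The generators
  -- x^q and y^q then meet the ends k = n and k = 0, where h vanishes; z^q misses the strip, and f
  -- gives the recurrence.
  let φ : (Fin 8 →₀ ℕ) → B := fun β =>
    if β 5 = q - n + β 2 ∧ β 6 = q - n + β 3 ∧ β 2 + β 3 = n ∧ β 7 = q - 2 ∧ β 4 = 0 then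
      τ ^ β 1 * lucasSeq 1 τ (β 2) else 0
  let L : MvPolynomial (Fin 8) K →ₗ[K] B := (basisMonomials (Fin 8) K).constr K φ
  have hL : ∀ β k, L (monomial β k) = k • φ β := by
    intro β k
    rw [← mul_one k, ← smul_eq_mul, ← smul_monomial, map_smul, smul_eq_mul, mul_one]
    congr 1
    exact (basisMonomials (Fin 8) K).constr_basis K φ β
  have hgen : ∀ a, (∀ β k, L (monomial β k * a) = 0) → ∀ b, L (b * a) = 0 := by
    intro a ha b
    induction b using MvPolynomial.induction_on' with
    | monomial β k => exact ha β k
    | add b c hb hc => rw [add_mul, map_add, hb, hc, add_zero]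
  refine ⟨L, ?_, ?_⟩
  · intro b hb
    suffices ∀ c, L (c * b) = 0 by simpa using this 1
    refine Submodule.span_induction (p := fun b _ => ∀ c, L (c * b) = 0) ?_ ?_ ?_ ?_ hb
    · rintro b (rfl | rfl | rfl | rfl)
      · refine hgen _ fun β k => ?_
        rw [← monomial_add_single, hL]
        simp only [φ]
        split_ifs with h
        · simp at h ⊢
          rw [show β 2 = n by omega, hτ]
          simp
        · simp
      · refine hgen _ fun β k => ?_
        rw [← monomial_add_single, hL]
        simp only [φ]
        split_ifs with h
        · simp at h ⊢
          rw [show β 2 = 0 by omega]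
          simp [lucasSeq]
        · simp
      · refine hgen _ fun β k => ?_
        rw [← monomial_add_single, hL]
        simp only [φ]
        rw [if_neg, smul_zero]
        intro h
        simp at h
        omega
      · refine hgen _ fun β k => ?_
        have h : monomial β k * poly K =
            monomial β k * X 0 ^ 1 * X 2 ^ 2 * X 5 ^ 2 + monomial β k * X 0 ^ 1 * X 3 ^ 2 * X 6 ^ 2 +
            monomial β k * X 1 ^ 1 * X 2 ^ 1 * X 5 ^ 1 * X 3 ^ 1 * X 6 ^ 1 +
            monomial β k * X 1 ^ 1 * X 4 ^ 2 * X 7 ^ 2 := by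
          simp only [poly]
          ring
        rw [h]
        simp only [← monomial_add_single, map_add, hL, ← smul_add]
        convert smul_zero k
        simp only [φ, Finsupp.add_apply, Finsupp.single_apply, Fin.reduceEq, if_true, if_false,
          add_zero]
        -- Exactly in this case the first three terms of f land on strip positions k+2, k and k+1,
        -- with k = `β 2`; the fourth always has positive w-exponent.
        by_cases hC : β 5 = q - n + β 2 ∧ β 6 = q - n + β 3 ∧ β 2 + β 3 + 2 = n ∧ β 7 = q - 2 ∧
          β 4 = 0
        · rw [if_pos (by omega), if_pos (by omega), if_pos (by omega), if_neg (by omega)]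
          simp only [lucasSeq]
          ring
        · rw [if_neg (by omega), if_neg (by omega), if_neg (by omega), if_neg (by omega)]
          simp
    · simp
    · intro a b _ _ ha hb c
      rw [mul_add, map_add, ha, hb, add_zero]
    · intro r a _ ha c
      rw [smul_eq_mul, ← mul_assoc]
      exact ha _
  · intro N
    have h : X 0 ^ N * stripMonomial K q n 1 = monomial 0 1 * X 0 ^ N * X 5 ^ (q - n + 1) * X 2 ^ 1 *
        X 6 ^ (q - 1) * X 3 ^ (n - 1) * X 7 ^ (q - 2) := by
      rw [stripMonomial, monomial_zero', map_one]
      ring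
    rw [h]
    simp only [← monomial_add_single, hL, one_smul]
    simp only [φ, Finsupp.add_apply, Finsupp.single_apply, Fin.reduceEq, if_true, if_false,
          add_zero, zero_add]
    rw [if_pos ⟨trivial, by omega, by omega, trivial, trivial⟩]
    simp [lucasSeq]

theorem X_pow_mul_stripMonomial_notMem {q n : ℕ} (hn : 2 ≤ n) (hq : n ≤ q) (N : ℕ) :
    X 0 ^ N * stripMonomial K q n 1 ∉ polyPowIdeal K q := by
  obtain ⟨B, _, _, _, τ, hτ⟩ := exists_lucasSeq_eq_zero K hn
  obtain ⟨L, hL, hL1⟩ := exists_linearMap_polyPowIdeal K hn hq τ hτ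
  exact fun h => one_ne_zero ((hL1 N).symm.trans (hL _ h))

theorem exists_associatedPrime_lucasSeq_mem {q n : ℕ} (hn : 2 ≤ n) (hq : n ≤ q) :
    ∃ P ∈ associatedPrimes (S K) (S K ⧸ powIdeal K q),
      Ideal.Quotient.mk _ (X 0) ∉ P ∧
      lucasSeq (Ideal.Quotient.mk _ (X 0)) (Ideal.Quotient.mk _ (X 1)) n ∈ P := by
  let π : MvPolynomial (Fin 8) K →+* S K := Ideal.Quotient.mk _
  have hmk : ∀ a b : MvPolynomial (Fin 8) K,
      π a • Ideal.Quotient.mk (powIdeal K q) (π b) = 0 ↔ a * b ∈ polyPowIdeal K q := by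
    intro a b
    rw [← mk_mem_powIdeal_iff, ← Ideal.Quotient.eq_zero_iff_mem, map_mul]
    rfl
  obtain ⟨P, hP, hs, hg⟩ := exists_isAssociatedPrime_notMem
    (Ideal.Quotient.mk (powIdeal K q) (π (stripMonomial K q n 1))) (π (X 0))
    (π (X 0 * lucasSeq (X 0) (X 1) n))
    (fun N => by
      rw [← map_pow, Ne, hmk]
      exact X_pow_mul_stripMonomial_notMem K hn hq N)
    ((hmk _ _).2 (lucasSeq_mul_stripMonomial_mem K hn hq))
  refine ⟨P, hP, hs, ?_⟩
  rw [map_mul, map_lucasSeq] at hg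
  exact (hP.isPrime.mem_or_mem hg).resolve_left hs

theorem infinite_iUnion_associatedPrimes (p : ℕ) (hp : 1 < p) :
    (⋃ e : ℕ, associatedPrimes (S K) (S K ⧸ powIdeal K (p ^ e))).Infinite := by
  have h : ∀ l : Nat.Primes, ∃ P ∈ ⋃ e : ℕ, associatedPrimes (S K) (S K ⧸ powIdeal K (p ^ e)),
      Ideal.Quotient.mk _ (X 0) ∉ P ∧
      lucasSeq (Ideal.Quotient.mk _ (X 0)) (Ideal.Quotient.mk _ (X 1)) (l : ℕ) ∈ P := by
    intro l
    -- For the prime l the exponent e = l is taken; only l ≤ p^l is needed.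
    obtain ⟨P, hP, h⟩ := exists_associatedPrime_lucasSeq_mem K l.2.two_le (Nat.lt_pow_self hp).le
    exact ⟨P, Set.mem_iUnion.2 ⟨_, hP⟩, h⟩
  choose P hP hs hl using h
  refine Set.infinite_of_injective_forall_mem (f := P) (fun l m hlm => ?_) hP
  by_contra hne
  obtain ⟨e, he⟩ := Set.mem_iUnion.1 (hP l)
  have := IsAssociatedPrime.isPrime he
  exact not_coprime_of_lucasSeq_mem (hs l) (hl l) (hlm ▸ hl m)
    ((Nat.coprime_primes l.2 m.2).2 fun h => hne (Subtype.ext h))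

end SinghSwanson

theorem mainTheorem3 (p : ℕ) [Fact p.Prime] (K : Type*) [Field K] [CharP K p] :
    IsFRegular p (SinghSwanson.S K) (SinghSwanson.natCast_eq_zero p K) ∧
    (⋃ e : ℕ, associatedPrimes (SinghSwanson.S K)
        (SinghSwanson.S K ⧸ SinghSwanson.powIdeal K (p ^ e))) =
      (⋃ e : ℕ, associatedPrimes (SinghSwanson.S K)
        (SinghSwanson.S K ⧸ tightClosure p (SinghSwanson.natCast_eq_zero p K)
          (SinghSwanson.powIdeal K (p ^ e)))) ∧
    (⋃ e : ℕ, associatedPrimes (SinghSwanson.S K)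
        (SinghSwanson.S K ⧸ SinghSwanson.powIdeal K (p ^ e))).Infinite ∧
    (⋃ e : ℕ, associatedPrimes (SinghSwanson.S K)
        (SinghSwanson.S K ⧸ tightClosure p (SinghSwanson.natCast_eq_zero p K)
          (SinghSwanson.powIdeal K (p ^ e)))).Infinite := by
  have hsplit := SinghSwanson.hasFrobeniusSplittings (K := K) p
  have : IsLocalization (⊥ : Submonoid (SinghSwanson.S K)) (SinghSwanson.S K) :=
    IsLocalization.self bot_le
  have htc : ∀ I : Ideal (SinghSwanson.S K),
      tightClosure p (SinghSwanson.natCast_eq_zero p K) I = I :=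
    tightClosure_eq_self_of_hasFrobeniusSplittings p hsplit ⊥ bot_le _
  have hinf := SinghSwanson.infinite_iUnion_associatedPrimes K p (Fact.out : p.Prime).one_lt
  have heq : (⋃ e : ℕ, associatedPrimes (SinghSwanson.S K)
        (SinghSwanson.S K ⧸ tightClosure p (SinghSwanson.natCast_eq_zero p K)
          (SinghSwanson.powIdeal K (p ^ e)))) =
      ⋃ e : ℕ, associatedPrimes (SinghSwanson.S K)
        (SinghSwanson.S K ⧸ SinghSwanson.powIdeal K (p ^ e)) :=
    Set.iUnion_congr fun e => by rw [htc]
  exact ⟨isFRegular_of_hasFrobeniusSplittings p _ hsplit, heq.symm, hinf, heq ▸ hinf⟩
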